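/- For $f:\{0,1\}^\ell\to\{0,1\}$ write $\Pr[f=1]$ for the fraction of inputs $x\in\{0,1\}^\ell$ with $f(x)=1$. For $B\subseteq[\ell]$ let $f|_B:\{0,1\}^\ell\to\{0,1\}$ be the function with $f|_B(x)=1$ if and only if there is $y\in\{0,1\}^\ell$ with $y_i=x_i$ for all $i\notin B$ and $f(y)=1$ (the players in $B$ choose their bits after seeing all the others, aiming for the value $1$). We say that $B$ can $0.99$-bias $f$ towards $1$ if $\Pr[f|_B=1]\ge 0.99$. There is a universal constant $C>0$ such that for every integer $\ell\ge 0$ and every real $h$ with $1\le h\le \ell^{0.99}$ there is an integer $0\le r_0\le \ell$ with $r_0\log h\le C\ell$ (that is, $r_0=O(\ell/\log h)$) for which the following holds. Let $r$ be any integer with $r_0\le r\le \ell$, and let $f:\{0,1\}^\ell\to\{0,1\}$ satisfy $\Pr[f=1]\ge 0.01$. Then for at least a $0.99$ fraction of all sets $B_R\subseteq[\ell]$ with $|B_R|=r$ there is a set $B_H=B_H(B_R)\subseteq[\ell]$ with $|B_H|\le h$ such that $B_R\cup B_H$ can $0.99$-bias $f$ towards $1$. -/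

import Mathlib

open Finset

/-- The probability that the Boolean function `f` on `ℓ` bits takes the value `1`
on a uniformly random input. -/
noncomputable def prOne {ℓ : ℕ} (f : (Fin ℓ → Bool) → Bool) : ℝ :=
  (#{x : Fin ℓ → Bool | f x = true} : ℝ) / 2 ^ ℓ

open Classical in
/-- The function `f|_B`: the players outside `B` play the bits of `x`, and then the players in `B`,
having seen these bits, choose their own bits so as to make `f` equal to `1` if this is possible.
The bits of `x` at positions in `B` are irrelevant. -/
noncomputable def corrupt {ℓ : ℕ} (f : (Fin ℓ → Bool) → Bool) (B : Finset (Fin ℓ)) :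
    (Fin ℓ → Bool) → Bool :=
  fun x => decide (∃ y : Fin ℓ → Bool, (∀ i, i ∉ B → y i = x i) ∧ f y = true)

/-- The set `B` of bad players can `p`-bias `f` towards `1`: `Pr[f|_B = 1] ≥ p`. -/
def CanBias {ℓ : ℕ} (f : (Fin ℓ → Bool) → Bool) (B : Finset (Fin ℓ)) (p : ℝ) : Prop :=
  p ≤ prOne (corrupt f B)

/-! Take d = ⌊(log h)/6⌋, so that 2·81^d ≤ h when d > 0, and let p be the probability that a
coalition R ∪ H forces the value 1, with R random and H chosen. While 0.01 ≤ p ≤ 0.99, the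
Kahn–Kalai–Linial inequality leaves two cases (`sum_gain_ge`). Either one player raises p by more
than 81⁻ᵈ/2: it joins H, at most 2·81^d times in all because p ≤ 1 (`exists_saturation`). Or the
gains of all players add up to at least 0.0099·d, so a random new member of R raises p by at least
0.0099·d/ℓ on average. Since 1 - p cannot become negative, s random additions fail to reach 0.99
with probability at most ℓ(1 - p)/(0.0099·d·s); `card_bad_extensions_le` proves this by induction on
s. For s ≥ 20000·ℓ/d this is below 0.01. -/

/-! ### Walsh expansion on the discrete cube -/

/-- The Walsh character of the set `S`. -/
noncomputable def walsh {ι : Type*} (S : Finset ι) (x : ι → Bool) : ℝ :=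
  ∏ i ∈ S, if x i then -1 else 1

/-- The Walsh coefficient of `F` at `S`. -/
noncomputable def walshCoeff {ι : Type*} [Fintype ι] [DecidableEq ι] (F : (ι → Bool) → ℝ)
    (S : Finset ι) : ℝ :=
  (∑ x, F x * walsh S x) / 2 ^ Fintype.card ι

/-- Negate the bit at position `i`. -/
def flipBit {ι : Type*} [DecidableEq ι] (i : ι) (x : ι → Bool) : ι → Bool :=
  Function.update x i (!x i)

section Walsh

lemma walsh_mul_self {ι : Type*} (S : Finset ι) (x : ι → Bool) : walsh S x * walsh S x = 1 := by
  rw [walsh, ← prod_mul_distrib]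
  exact prod_eq_one fun i _ => by split_ifs <;> norm_num

lemma sum_walsh_mul_walsh {ι : Type*} [Fintype ι] (x y : ι → Bool) :
    ∑ S : Finset ι, walsh S x * walsh S y = if x = y then 2 ^ Fintype.card ι else 0 := by
  classical
  have h1 : ∑ S : Finset ι, walsh S x * walsh S y
      = ∏ i : ι, (1 + (if x i then (-1 : ℝ) else 1) * (if y i then -1 else 1)) := by
    rw [prod_one_add, powerset_univ]
    exact sum_congr rfl fun S _ => (prod_mul_distrib).symm
  rw [h1]
  split_ifs with h
  · subst h
    rw [← card_univ, ← prod_const]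
    exact prod_congr rfl fun i _ => by split_ifs <;> norm_num
  · obtain ⟨i, hi⟩ := Function.ne_iff.mp h
    refine prod_eq_zero (mem_univ i) ?_
    cases hx : x i <;> cases hy : y i <;> simp_all

variable {ι : Type*} [DecidableEq ι]

lemma flipBit_flipBit (i : ι) (x : ι → Bool) : flipBit i (flipBit i x) = x := by
  funext j
  by_cases h : j = i
  · subst h; simp [flipBit]
  · simp [flipBit, h]

lemma walsh_flipBit (S : Finset ι) (i : ι) (x : ι → Bool) :
    walsh S (flipBit i x) = if i ∈ S then -walsh S x else walsh S x := by
  have aux : ∀ T : Finset ι, i ∉ T → walsh T (flipBit i x) = walsh T x := by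
    intro T hT
    refine prod_congr rfl fun j hj => ?_
    have : j ≠ i := fun h => hT (h ▸ hj)
    simp [flipBit, this]
  split_ifs with h
  · have e : ∀ y : ι → Bool, walsh S y = (if y i then -1 else 1) * walsh (S.erase i) y :=
      fun y => (mul_prod_erase S _ h).symm
    rw [e, e, aux _ (notMem_erase i S)]
    cases hx : x i <;> simp [flipBit, hx]
  · exact aux S h

lemma walsh_insert {S : Finset ι} {i : ι} (h : i ∉ S) (x : ι → Bool) :
    walsh (insert i S) x = walsh {i} x * walsh S x := by
  simp [walsh, prod_insert h]

variable [Fintype ι]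

lemma sum_flipBit (i : ι) (F : (ι → Bool) → ℝ) : ∑ x, F (flipBit i x) = ∑ x, F x :=
  Equiv.sum_comp (Function.Involutive.toPerm (flipBit i) (flipBit_flipBit i)) F

lemma sum_eq_zero_of_flipBit (i : ι) (F : (ι → Bool) → ℝ) (hF : ∀ x, F (flipBit i x) = -F x) :
    ∑ x, F x = 0 := by
  have h := sum_flipBit i F
  simp only [hF, sum_neg_distrib] at h
  linarith

lemma walsh_inversion (F : (ι → Bool) → ℝ) (x : ι → Bool) :
    ∑ S, walshCoeff F S * walsh S x = F x := by
  simp only [walshCoeff, div_mul_eq_mul_div, sum_mul, ← sum_div]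
  rw [sum_comm]
  simp only [mul_assoc, ← mul_sum, sum_walsh_mul_walsh]
  simp

lemma sum_mul_walsh_sum (F : (ι → Bool) → ℝ) (b : Finset ι → ℝ) :
    ∑ x, F x * ∑ S, b S * walsh S x
      = 2 ^ Fintype.card ι * ∑ S, b S * walshCoeff F S := by
  simp only [mul_sum]
  rw [sum_comm]
  refine sum_congr rfl fun S _ => ?_
  rw [walshCoeff, mul_left_comm, mul_div_cancel₀ _ (by positivity), mul_sum]
  exact sum_congr rfl fun x _ => by ring

lemma walsh_parseval (F : (ι → Bool) → ℝ) :
    ∑ x, F x ^ 2 = 2 ^ Fintype.card ι * ∑ S, walshCoeff F S ^ 2 := by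
  simp only [sq, ← sum_mul_walsh_sum, walsh_inversion]

/-! ### Hypercontractivity and the Kahn–Kalai–Linial inequality -/

/-- Bonami's inequality, comparing the fourth moment with a weighted second moment. -/
lemma bonami_four (b : Finset ι → ℝ) (T : Finset ι) :
    (∑ x : ι → Bool, (∑ S ∈ T.powerset, b S * walsh S x) ^ 4)
      ≤ 2 ^ Fintype.card ι * (∑ S ∈ T.powerset, 3 ^ #S * b S ^ 2) ^ 2 := by
  induction T using Finset.induction_on generalizing b with
  | empty =>
    simp only [powerset_empty, sum_singleton, card_empty, walsh, prod_empty]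
    simp [← pow_mul]
  | insert i T hi ih =>
    have hins : ∀ S ∈ T.powerset, i ∉ S := fun S hS h => hi (mem_powerset.mp hS h)
    set P : (ι → Bool) → ℝ := fun x => ∑ S ∈ T.powerset, b S * walsh S x with hP
    set Q : (ι → Bool) → ℝ := fun x => ∑ S ∈ T.powerset, b (insert i S) * walsh S x with hQ
    set p := ∑ S ∈ T.powerset, 3 ^ #S * b S ^ 2 with hp
    set q := ∑ S ∈ T.powerset, 3 ^ #S * b (insert i S) ^ 2 with hq
    have hp0 : 0 ≤ p := sum_nonneg fun _ _ => by positivity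
    have hq0 : 0 ≤ q := sum_nonneg fun _ _ => by positivity
    have hsplit : ∀ x, ∑ S ∈ (insert i T).powerset, b S * walsh S x
        = P x + walsh {i} x * Q x := by
      intro x
      rw [sum_powerset_insert hi, hP, hQ]
      simp only [mul_sum]
      congr 1
      refine sum_congr rfl fun S hS => ?_
      rw [walsh_insert (hins S hS)]; ring
    have hrhs : ∑ S ∈ (insert i T).powerset, 3 ^ #S * b S ^ 2 = p + 3 * q := by
      rw [sum_powerset_insert hi, hp, hq, mul_sum]
      congr 1
      refine sum_congr rfl fun S hS => ?_
      rw [card_insert_of_notMem (hins S hS), pow_succ]; ring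
    have hPf : ∀ x, P (flipBit i x) = P x := fun x => sum_congr rfl fun S hS => by
      rw [walsh_flipBit, if_neg (hins S hS)]
    have hQf : ∀ x, Q (flipBit i x) = Q x := fun x => sum_congr rfl fun S hS => by
      rw [walsh_flipBit, if_neg (hins S hS)]
    have hwf : ∀ x, walsh {i} (flipBit i x) = -walsh {i} x := fun x => by
      rw [walsh_flipBit, if_pos (mem_singleton_self i)]
    have hw : ∀ x, walsh {i} x ^ 2 = 1 := fun x => by rw [sq, walsh_mul_self]
    -- Terms odd in the new character change sign under flipping bit i, so they cancel.
    have hodd : ∑ x, walsh {i} x * (4 * P x ^ 3 * Q x + 4 * P x * Q x ^ 3) = 0 :=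
      sum_eq_zero_of_flipBit i _ fun x => by rw [hPf, hQf, hwf]; ring
    have hexp : ∑ x, (P x + walsh {i} x * Q x) ^ 4
        = ∑ x, P x ^ 4 + 6 * ∑ x, P x ^ 2 * Q x ^ 2 + ∑ x, Q x ^ 4 := by
      rw [← add_zero (∑ x, P x ^ 4 + _ + _), ← hodd, mul_sum, ← sum_add_distrib,
        ← sum_add_distrib, ← sum_add_distrib]
      refine sum_congr rfl fun x _ => ?_
      linear_combination (6 * P x ^ 2 * Q x ^ 2 + 4 * P x * Q x ^ 3 * walsh {i} x
        + Q x ^ 4 * (walsh {i} x ^ 2 + 1)) * hw x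
    have hPb : ∑ x, P x ^ 4 ≤ 2 ^ Fintype.card ι * p ^ 2 := ih b
    have hQb : ∑ x, Q x ^ 4 ≤ 2 ^ Fintype.card ι * q ^ 2 := ih fun S => b (insert i S)
    have hPQ : ∑ x, P x ^ 2 * Q x ^ 2 ≤ 2 ^ Fintype.card ι * (p * q) := by
      refine abs_le_of_sq_le_sq' ?_ (by positivity) |>.2
      have hcs := sum_mul_sq_le_sq_mul_sq univ (fun x => P x ^ 2) (fun x => Q x ^ 2)
      simp only [← pow_mul] at hcs
      norm_num only at hcs
      refine hcs.trans ((mul_le_mul hPb hQb (sum_nonneg fun _ _ => by positivity)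
        (by positivity)).trans_eq (by ring))
    simp only [hsplit]
    rw [hrhs, hexp]
    -- The bound obtained is p² + 6pq + q², while (p + 3q)² has 9q² instead.
    have : (0 : ℝ) ≤ 2 ^ Fintype.card ι * q ^ 2 := by positivity
    linarith

/-- Hypercontractive bound for functions with values in `{-1, 0, 1}`. -/
lemma sq_sum_walshCoeff_le (g : (ι → Bool) → ℝ) (hg : ∀ x, g x ^ 3 = g x) :
    (∑ S, (1 / 3 : ℝ) ^ #S * walshCoeff g S ^ 2) ^ 2
      ≤ ((∑ x, g x ^ 2) / 2 ^ Fintype.card ι) ^ 3 := by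
  set N : ℝ := 2 ^ Fintype.card ι with hN
  have hN0 : 0 < N := by positivity
  set A := ∑ S, (1 / 3 : ℝ) ^ #S * walshCoeff g S ^ 2 with hA
  have hA0 : 0 ≤ A := sum_nonneg fun _ _ => by positivity
  set G := ∑ x, g x ^ 2 with hG
  have hG0 : 0 ≤ G := sum_nonneg fun _ _ => by positivity
  -- Noise with parameter 1/3: its fourth moment is controlled by Bonami, and its pairing with g is
  -- N·A.
  set u : (ι → Bool) → ℝ := fun x => ∑ S, ((1 / 3 : ℝ) ^ #S * walshCoeff g S) * walsh S x with hu
  have h4 : ∑ x, u x ^ 4 ≤ N * A ^ 2 := by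
    have h := bonami_four (fun S => (1 / 3 : ℝ) ^ #S * walshCoeff g S) (univ : Finset ι)
    rw [powerset_univ] at h
    refine h.trans_eq ?_
    congr 2
    refine sum_congr rfl fun S _ => ?_
    have : (3 : ℝ) ^ #S * (1 / 3) ^ #S = 1 := by rw [← mul_pow]; norm_num
    linear_combination ((1 / 3 : ℝ) ^ #S * walshCoeff g S ^ 2) * this
  have h1 : ∑ x, g x * u x = N * A := by
    rw [hu, sum_mul_walsh_sum, hA]
    congr 1
    exact sum_congr rfl fun S _ => by ring
  -- Since g = g³, two uses of Cauchy–Schwarz replace Hölder with exponents 4/3 and 4.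
  have h2 : (∑ x, g x * u x) ^ 2 ≤ G * ∑ x, g x ^ 2 * u x ^ 2 := by
    have hcs := sum_mul_sq_le_sq_mul_sq univ g (fun x => g x ^ 2 * u x)
    have e1 : ∑ x, g x * (g x ^ 2 * u x) = ∑ x, g x * u x :=
      sum_congr rfl fun x _ => by linear_combination u x * hg x
    have e2 : ∑ x, (g x ^ 2 * u x) ^ 2 = ∑ x, g x ^ 2 * u x ^ 2 :=
      sum_congr rfl fun x _ => by linear_combination g x * u x ^ 2 * hg x
    rwa [e1, e2] at hcs
  have h3 : (∑ x, g x ^ 2 * u x ^ 2) ^ 2 ≤ G * ∑ x, u x ^ 4 := by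
    have hcs := sum_mul_sq_le_sq_mul_sq univ (fun x => g x ^ 2) (fun x => u x ^ 2)
    have e1 : ∑ x, (g x ^ 2) ^ 2 = G := sum_congr rfl fun x _ => by linear_combination g x * hg x
    have e2 : ∑ x, (u x ^ 2) ^ 2 = ∑ x, u x ^ 4 := sum_congr rfl fun x _ => by ring
    rwa [e1, e2] at hcs
  rw [h1] at h2
  have h5 : (N * A) ^ 4 ≤ G ^ 3 * (N * A ^ 2) := by
    calc (N * A) ^ 4 = ((N * A) ^ 2) ^ 2 := by ring
      _ ≤ (G * ∑ x, g x ^ 2 * u x ^ 2) ^ 2 := pow_le_pow_left₀ (by positivity) h2 2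
      _ = G ^ 2 * (∑ x, g x ^ 2 * u x ^ 2) ^ 2 := by ring
      _ ≤ G ^ 2 * (G * (N * A ^ 2)) := by gcongr; exact h3.trans (by gcongr)
      _ = _ := by ring
  rcases hA0.eq_or_lt with h | h
  · rw [← h, zero_pow two_ne_zero]; exact pow_nonneg (div_nonneg hG0 hN0.le) 3
  · rw [div_pow, le_div_iff₀ (by positivity)]
    refine le_of_mul_le_mul_right ?_ (show 0 < N * A ^ 2 by positivity)
    linarith

lemma walshCoeff_sub_flipBit (F : (ι → Bool) → ℝ) (i : ι) (S : Finset ι) :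
    walshCoeff (fun x => F x - F (flipBit i x)) S = if i ∈ S then 2 * walshCoeff F S else 0 := by
  have h : ∑ x, F (flipBit i x) * walsh S x = ∑ x, F x * walsh S (flipBit i x) := by
    rw [← sum_flipBit i]; simp only [flipBit_flipBit]
  simp only [walshCoeff, sub_mul, sum_sub_distrib, h, walsh_flipBit]
  split_ifs
  · simp only [mul_neg, sum_neg_distrib]; ring
  · simp

/-- The Kahn–Kalai–Linial inequality: if all influences are at most `81⁻ᵈ`, then the total
influence is at least `2 d` times the variance. -/
theorem kahn_kalai_linial (F : (ι → Bool) → ℝ) (hF : ∀ x, F x ^ 2 = F x) (d : ℕ) (hd : 0 < d)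
    (hinf : ∀ i, (∑ x, (F x - F (flipBit i x)) ^ 2) / 2 ^ Fintype.card ι ≤ (1 / 81 : ℝ) ^ d) :
    2 * d * ((∑ x, F x) / 2 ^ Fintype.card ι * (1 - (∑ x, F x) / 2 ^ Fintype.card ι))
      ≤ ∑ i, (∑ x, (F x - F (flipBit i x)) ^ 2) / 2 ^ Fintype.card ι := by
  set N : ℝ := 2 ^ Fintype.card ι with hN
  have hN0 : 0 < N := by positivity
  set I : ι → ℝ := fun i => (∑ x, (F x - F (flipBit i x)) ^ 2) / N with hI
  set c := walshCoeff F with hc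
  have hI0 : ∀ i, 0 ≤ I i := fun i => div_nonneg (sum_nonneg fun _ _ => sq_nonneg _) hN0.le
  have hcount : ∀ w : Finset ι → ℝ, ∑ i, ∑ S, w S * walshCoeff (fun x => F x - F (flipBit i x)) S ^ 2
      = ∑ S, 4 * #S * w S * c S ^ 2 := by
    intro w
    rw [sum_comm]
    refine sum_congr rfl fun S _ => ?_
    simp only [walshCoeff_sub_flipBit, ite_pow, mul_ite, ← hc]
    simp only [ne_eq, OfNat.ofNat_ne_zero, not_false_eq_true, zero_pow, mul_zero, sum_ite_mem,
      univ_inter, sum_const, nsmul_eq_mul]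
    ring
  have hItot : ∑ i, I i = ∑ S, 4 * #S * c S ^ 2 := by
    have h := hcount fun _ => 1
    simp only [one_mul, mul_one] at h
    rw [← h]
    refine sum_congr rfl fun i _ => ?_
    rw [hI]
    simp only
    rw [walsh_parseval, mul_div_cancel_left₀ _ hN0.ne']
  -- Hypercontractivity bounds the square of each inner sum by Iᵢ³ ≤ 81⁻ᵈ Iᵢ² = (9⁻ᵈ Iᵢ)².
  have hlow : ∑ S, 4 * #S * (1 / 3 : ℝ) ^ #S * c S ^ 2 ≤ (1 / 9 : ℝ) ^ d * ∑ i, I i := by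
    rw [← hcount, mul_sum]
    refine sum_le_sum fun i _ => ?_
    refine abs_le_of_sq_le_sq' ?_ (mul_nonneg (by positivity) (hI0 i)) |>.2
    refine (sq_sum_walshCoeff_le _ fun x => ?_).trans ?_
    · have h1 := hF x
      have h2 := hF (flipBit i x)
      have h1' : F x = 0 ∨ F x = 1 := by
        rcases eq_or_ne (F x) 0 with h | h
        · exact Or.inl h
        · exact Or.inr (mul_left_cancel₀ h (by linarith))
      have h2' : F (flipBit i x) = 0 ∨ F (flipBit i x) = 1 := by
        rcases eq_or_ne (F (flipBit i x)) 0 with h | h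
        · exact Or.inl h
        · exact Or.inr (mul_left_cancel₀ h (by linarith))
      rcases h1' with h | h <;> rcases h2' with h' | h' <;> rw [h, h'] <;> norm_num
    · calc I i ^ 3 = I i * I i ^ 2 := by ring
        _ ≤ (1 / 81 : ℝ) ^ d * I i ^ 2 := by gcongr; exact hinf i
        _ = _ := by
          rw [mul_pow, ← pow_mul, mul_comm d 2, pow_mul]; norm_num
  have hvar : ∑ S, (if S = ∅ then 0 else 4 * c S ^ 2)
      = 4 * ((∑ x, F x) / N * (1 - (∑ x, F x) / N)) := by
    have h1 : ∑ S, c S ^ 2 = (∑ x, F x) / N := by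
      have h := walsh_parseval F
      simp only [hF] at h
      rw [h, mul_div_cancel_left₀ _ hN0.ne']
    have h2 : c ∅ = (∑ x, F x) / N := by simp [hc, walshCoeff, walsh, hN]
    have h3 : ∑ S, (if S = ∅ then 0 else 4 * c S ^ 2)
        = ∑ S, 4 * c S ^ 2 - ∑ S, (if S = ∅ then 4 * c S ^ 2 else 0) := by
      rw [← sum_sub_distrib]
      exact sum_congr rfl fun S _ => by split_ifs <;> simp
    rw [h3, sum_ite_eq' univ ∅, if_pos (mem_univ _), ← mul_sum, h1, h2]
    ring
  have hd0 : (0 : ℝ) < d := by exact_mod_cast hd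
  -- Levels up to d are paid by the first term, as 3^d·3^(-#S) ≥ 1; higher levels by the second, as
  -- #S/d ≥ 1.
  have hpt : ∀ S, (if S = ∅ then 0 else 4 * c S ^ 2)
      ≤ 3 ^ d * (4 * #S * (1 / 3 : ℝ) ^ #S * c S ^ 2) + 1 / d * (4 * #S * c S ^ 2) := by
    intro S
    split_ifs with h
    · positivity
    · have hS : (1 : ℝ) ≤ #S := by exact_mod_cast (nonempty_iff_ne_empty.mpr h).card_pos
      rcases le_total (#S) d with hle | hle
      · have h3 : (1 : ℝ) ≤ 3 ^ d * (1 / 3) ^ #S := by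
          rw [one_div, inv_pow, ← div_eq_mul_inv, one_le_div (by positivity)]
          exact pow_le_pow_right₀ (by norm_num) hle
        have h4 : 1 ≤ 3 ^ d * (1 / 3 : ℝ) ^ #S * #S := one_le_mul_of_one_le_of_one_le h3 hS
        have h5 : (0 : ℝ) ≤ 1 / d * (4 * #S * c S ^ 2) := by positivity
        nlinarith [mul_le_mul_of_nonneg_right h4 (show 0 ≤ 4 * c S ^ 2 by positivity)]
      · have h4 : (1 : ℝ) ≤ 1 / d * #S := by
          rw [one_div, inv_mul_eq_div, one_le_div hd0]; exact_mod_cast hle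
        have h5 : (0 : ℝ) ≤ 3 ^ d * (4 * #S * (1 / 3 : ℝ) ^ #S * c S ^ 2) := by positivity
        nlinarith [mul_le_mul_of_nonneg_right h4 (show 0 ≤ 4 * c S ^ 2 by positivity)]
  have hsum := sum_le_sum fun S (_ : S ∈ (univ : Finset (Finset ι))) => hpt S
  rw [hvar, sum_add_distrib, ← mul_sum, ← mul_sum, ← hItot] at hsum
  have hIt0 : 0 ≤ ∑ i, I i := sum_nonneg fun i _ => hI0 i
  have h39 : (3 : ℝ) ^ d * ((1 / 9 : ℝ) ^ d * ∑ i, I i) ≤ 1 / d * ∑ i, I i := by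
    rw [← mul_assoc, ← mul_pow]
    refine mul_le_mul_of_nonneg_right ?_ hIt0
    have hd3 : (d : ℝ) ≤ 3 ^ d := by exact_mod_cast (Nat.lt_pow_self (by norm_num : 1 < 3)).le
    have : (3 * (1 / 9) : ℝ) ^ d = 1 / 3 ^ d := by rw [← one_div_pow]; norm_num
    rw [this]
    exact one_div_le_one_div_of_le hd0 hd3
  have hfin : 4 * ((∑ x, F x) / N * (1 - (∑ x, F x) / N)) ≤ 2 * (1 / d * ∑ i, I i) := by
    have := mul_le_mul_of_nonneg_left hlow (show (0 : ℝ) ≤ 3 ^ d by positivity)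
    linarith
  have := mul_le_mul_of_nonneg_left hfin hd0.le
  have e : (d : ℝ) * (2 * (1 / d * ∑ i, I i)) = 2 * ∑ i, I i := by field_simp
  rw [e] at this
  linarith

end Walsh

/-! ### Coalitions -/

lemma corrupt_eq_true_iff {ℓ : ℕ} (f : (Fin ℓ → Bool) → Bool) (B : Finset (Fin ℓ))
    (x : Fin ℓ → Bool) :
    corrupt f B x = true ↔ ∃ y : Fin ℓ → Bool, (∀ i, i ∉ B → y i = x i) ∧ f y = true := by
  simp [corrupt]

lemma corrupt_corrupt {ℓ : ℕ} (f : (Fin ℓ → Bool) → Bool) (A B : Finset (Fin ℓ)) :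
    corrupt (corrupt f A) B = corrupt f (A ∪ B) := by
  funext x
  rw [Bool.eq_iff_iff]
  simp only [corrupt_eq_true_iff]
  constructor
  · rintro ⟨y, hy, z, hz, hf⟩
    refine ⟨z, fun i hi => ?_, hf⟩
    rw [mem_union, not_or] at hi
    rw [hz i hi.1, hy i hi.2]
  · rintro ⟨z, hz, hf⟩
    -- The intermediate point is the hybrid with B already playing z and all others still at x.
    refine ⟨fun i => if i ∈ B then z i else x i, fun i hi => by simp [hi], z, fun i hi => ?_, hf⟩
    by_cases hB : i ∈ B
    · simp [hB]
    · simp [hB, hz i (by simp [hi, hB])]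

lemma corrupt_singleton {ℓ : ℕ} (f : (Fin ℓ → Bool) → Bool) (i : Fin ℓ) (x : Fin ℓ → Bool) :
    corrupt f {i} x = (f x || f (flipBit i x)) := by
  rw [Bool.eq_iff_iff, corrupt_eq_true_iff, Bool.or_eq_true]
  constructor
  · rintro ⟨y, hy, hf⟩
    by_cases h : y i = x i
    · left
      have : y = x := by
        funext j
        by_cases hj : j = i
        · rw [hj, h]
        · exact hy j (by simpa using hj)
      rwa [← this]
    · right
      have : y = flipBit i x := by
        funext j
        by_cases hj : j = i
        · subst hj; cases hx : x j <;> cases hyj : y j <;> simp_all [flipBit]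
        · simpa [flipBit, hj] using hy j (by simpa using hj)
      rwa [← this]
  · rintro (h | h)
    · exact ⟨x, fun _ _ => rfl, h⟩
    · exact ⟨flipBit i x, fun j hj => by
        rw [mem_singleton] at hj; simp [flipBit, hj], h⟩

lemma prOne_eq_sum {ℓ : ℕ} (f : (Fin ℓ → Bool) → Bool) :
    prOne f = (∑ x, if f x = true then (1 : ℝ) else 0) / 2 ^ ℓ := by
  rw [prOne, sum_boole]

lemma prOne_le_one {ℓ : ℕ} (f : (Fin ℓ → Bool) → Bool) : prOne f ≤ 1 := by
  rw [prOne, div_le_one (by positivity)]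
  calc (#{x : Fin ℓ → Bool | f x = true} : ℝ) ≤ #(univ : Finset (Fin ℓ → Bool)) := by
        exact_mod_cast card_filter_le _ _
    _ = 2 ^ ℓ := by simp

lemma prOne_corrupt_mono {ℓ : ℕ} (f : (Fin ℓ → Bool) → Bool) {A B : Finset (Fin ℓ)}
    (h : A ⊆ B) : prOne (corrupt f A) ≤ prOne (corrupt f B) := by
  rw [prOne, prOne]
  refine div_le_div_of_nonneg_right (Nat.cast_le.mpr (card_le_card fun x hx => ?_)) (by positivity)
  simp only [mem_filter, mem_univ, true_and, corrupt_eq_true_iff] at hx ⊢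
  obtain ⟨y, hy, hf⟩ := hx
  exact ⟨y, fun i hi => hy i fun hA => hi (h hA), hf⟩

lemma corrupt_empty {ℓ : ℕ} (f : (Fin ℓ → Bool) → Bool) : corrupt f ∅ = f := by
  funext x
  rw [Bool.eq_iff_iff, corrupt_eq_true_iff]
  constructor
  · rintro ⟨y, hy, hf⟩
    rwa [← funext fun i => hy i (notMem_empty i)]
  · exact fun h => ⟨x, fun _ _ => rfl, h⟩

/-- The gain of a player is half its influence, because 2(a ∨ b) = a + b + (a - b)² for bits. This
lets KKL speak about gains. -/
lemma prOne_corrupt_singleton_sub {ℓ : ℕ} (f : (Fin ℓ → Bool) → Bool) (i : Fin ℓ) :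
    2 * (prOne (corrupt f {i}) - prOne f)
      = (∑ x, ((if f x = true then (1 : ℝ) else 0)
          - if f (flipBit i x) = true then 1 else 0) ^ 2) / 2 ^ ℓ := by
  have h := sum_flipBit i fun x => if f x = true then (1 : ℝ) else 0
  rw [prOne_eq_sum, prOne_eq_sum, ← sub_div, mul_div_assoc']
  congr 1
  have key : ∀ x, 2 * (if corrupt f {i} x = true then (1 : ℝ) else 0)
      = (if f x = true then (1 : ℝ) else 0) + (if f (flipBit i x) = true then 1 else 0)
        + ((if f x = true then (1 : ℝ) else 0) - if f (flipBit i x) = true then 1 else 0) ^ 2 := by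
    intro x
    rw [corrupt_singleton]
    cases f x <;> cases f (flipBit i x) <;> norm_num
  rw [mul_sub, mul_sum, sum_congr rfl fun x _ => key x, sum_add_distrib, sum_add_distrib, h]
  ring

/-- Either some player gains noticeably, or the total gain of all players is large. -/
lemma sum_gain_ge {ℓ : ℕ} (f : (Fin ℓ → Bool) → Bool) {d : ℕ} (hd : 0 < d)
    (h1 : 0.01 ≤ prOne f) (h2 : prOne f ≤ 0.99)
    (hinf : ∀ i, prOne (corrupt f {i}) - prOne f ≤ (1 / 81 : ℝ) ^ d / 2) :
    0.0099 * d ≤ ∑ i, (prOne (corrupt f {i}) - prOne f) := by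
  have h := kahn_kalai_linial (fun x => if f x = true then (1 : ℝ) else 0)
    (fun x => by split_ifs <;> norm_num) d hd
  simp only [Fintype.card_fin, ← prOne_corrupt_singleton_sub, ← prOne_eq_sum, ← mul_sum] at h
  have h3 := h fun i => by linarith [hinf i]
  have hv : 0.0099 ≤ prOne f * (1 - prOne f) := by nlinarith
  have hd0 : (0 : ℝ) ≤ d := Nat.cast_nonneg d
  nlinarith [mul_le_mul_of_nonneg_left hv hd0]

/-- A set of players can be enlarged until it is winning or has large total gain, and the number of
added players is controlled by the gain in probability. -/
lemma exists_saturation {ℓ : ℕ} (f : (Fin ℓ → Bool) → Bool) {d : ℕ} (hd : 0 < d)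
    (R H : Finset (Fin ℓ)) (h1 : 0.01 ≤ prOne f)
    (hH : (#H : ℝ) ≤ 2 * 81 ^ d * prOne (corrupt f (R ∪ H))) :
    ∃ H', H ⊆ H' ∧ (#H' : ℝ) ≤ 2 * 81 ^ d * prOne (corrupt f (R ∪ H')) ∧
      (0.99 ≤ prOne (corrupt f (R ∪ H')) ∨
        0.0099 * d ≤ ∑ i, (prOne (corrupt f (insert i R ∪ H')) - prOne (corrupt f (R ∪ H')))) := by
  classical
  -- In a maximal H' no player can gain more than 81⁻ᵈ/2: such a gain pays for one more element in
  -- the size bound.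
  obtain ⟨H', hH', hmax⟩ := exists_max_image
    (univ.filter fun K : Finset (Fin ℓ) =>
      H ⊆ K ∧ (#K : ℝ) ≤ 2 * 81 ^ d * prOne (corrupt f (R ∪ K))) card
    ⟨H, by simpa using hH⟩
  simp only [mem_filter, mem_univ, true_and] at hH' hmax
  refine ⟨H', hH'.1, hH'.2, ?_⟩
  by_contra! hcon
  obtain ⟨hlt, hsum⟩ := hcon
  have hu : ∀ i, insert i R ∪ H' = (R ∪ H') ∪ {i} := fun i => by ext; simp
  simp only [hu, ← corrupt_corrupt f (R ∪ H')] at hsum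
  have h01 : 0.01 ≤ prOne (corrupt f (R ∪ H')) := by
    have := prOne_corrupt_mono f (empty_subset (R ∪ H'))
    rw [corrupt_empty] at this
    linarith
  refine hsum.not_ge (sum_gain_ge _ hd h01 hlt.le fun i => ?_)
  by_contra! hi
  rw [corrupt_corrupt] at hi
  have hmem : i ∉ R ∪ H' := fun hm => by
    rw [union_eq_left.mpr (singleton_subset_iff.mpr hm), sub_self] at hi
    have : (0 : ℝ) ≤ (1 / 81) ^ d / 2 := by positivity
    linarith
  have hiH : i ∉ H' := fun h => hmem (mem_union_right _ h)
  have hcard := hmax (insert i H') ⟨hH'.1.trans (subset_insert _ _), ?_⟩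
  · rw [card_insert_of_notMem hiH] at hcard
    omega
  · have e : R ∪ insert i H' = (R ∪ H') ∪ {i} := by ext; simp
    rw [e, card_insert_of_notMem hiH]
    push_cast
    have h81 : (0 : ℝ) < 2 * 81 ^ d := by positivity
    have := mul_lt_mul_of_pos_left hi h81
    have e2 : (2 * 81 ^ d : ℝ) * ((1 / 81) ^ d / 2) = 1 := by
      rw [one_div_pow]; field_simp
    rw [e2, mul_sub] at this
    linarith [hH'.2]

/-! ### Random growth of a set -/

/-- Double counting of the sets obtained from `R` by adding `s + 1` elements. -/
lemma sum_card_filter_powersetCard_insert {α : Type*} [Fintype α] [DecidableEq α]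
    (bad : Finset α → Prop) [DecidablePred bad] (R : Finset α) (s : ℕ) :
    ∑ i ∈ Rᶜ, #{S ∈ powersetCard s (insert i R)ᶜ | bad (insert i R ∪ S)}
      = (s + 1) * #{S ∈ powersetCard (s + 1) Rᶜ | bad (R ∪ S)} := by
  rw [← card_sigma, mul_comm, ← smul_eq_mul, ← sum_const]
  have : ∑ S ∈ powersetCard (s + 1) Rᶜ with bad (R ∪ S), (s + 1)
      = ∑ S ∈ powersetCard (s + 1) Rᶜ with bad (R ∪ S), #S :=
    sum_congr rfl fun S hS => (mem_powersetCard.mp (mem_filter.mp hS).1).2.symm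
  rw [this, ← card_sigma]
  -- The pair (i, S) corresponds to the set S ∪ {i} with i marked.
  refine card_bij' (fun a _ => ⟨insert a.1 a.2, a.1⟩) (fun b _ => ⟨b.2, b.1.erase b.2⟩) ?_ ?_ ?_ ?_
  · rintro ⟨i, S⟩ h
    simp only [mem_sigma, mem_filter, mem_powersetCard, mem_compl] at h ⊢
    obtain ⟨hi, ⟨hS, hc⟩, hb⟩ := h
    have hiS : i ∉ S := fun h => by simpa using hS h
    refine ⟨⟨⟨?_, by rw [card_insert_of_notMem hiS, hc]⟩, ?_⟩, mem_insert_self _ _⟩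
    · refine insert_subset (mem_compl.mpr hi) (hS.trans ?_)
      exact compl_subset_compl.mpr (subset_insert _ _)
    · rwa [union_insert, ← insert_union]
  · rintro ⟨S, i⟩ h
    simp only [mem_sigma, mem_filter, mem_powersetCard, mem_compl] at h ⊢
    obtain ⟨⟨⟨hS, hc⟩, hb⟩, hi⟩ := h
    refine ⟨mem_compl.mp (hS hi), ⟨?_, by rw [card_erase_of_mem hi, hc]; rfl⟩, ?_⟩
    · intro j hj
      have := hS (mem_of_mem_erase hj)
      simp_all
    · rwa [insert_union, ← union_insert, insert_erase hi]
  · rintro ⟨i, S⟩ h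
    simp only [mem_sigma, mem_filter, mem_powersetCard, mem_compl] at h
    have hiS : i ∉ S := fun hi => by simpa using h.2.1.1 hi
    simp [erase_insert hiS]
  · rintro ⟨S, i⟩ h
    simp only [mem_sigma] at h
    simp [insert_erase h.2]

open Classical in
/-- Bound on the number of ways to add `s` further elements to `R` without creating a set that a few
players can complete to a winning coalition. -/
lemma card_bad_extensions_le {ℓ : ℕ} (f : (Fin ℓ → Bool) → Bool) (h1 : 0.01 ≤ prOne f)
    {d : ℕ} (hd : 0 < d) {h : ℝ} (hh : 2 * 81 ^ d ≤ h) (s : ℕ) (R H : Finset (Fin ℓ))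
    (hH : (#H : ℝ) ≤ 2 * 81 ^ d * prOne (corrupt f (R ∪ H))) :
    s * (0.0099 * d) * (#{S ∈ powersetCard s Rᶜ |
        ¬∃ K : Finset (Fin ℓ), (#K : ℝ) ≤ h ∧ CanBias f ((R ∪ S) ∪ K) 0.99} : ℝ)
      ≤ ℓ * (1 - prOne (corrupt f (R ∪ H))) * (#Rᶜ).choose s := by
  induction s generalizing R H with
  | zero =>
    rw [Nat.cast_zero, zero_mul, zero_mul]
    have := prOne_le_one (corrupt f (R ∪ H))
    have : 0 ≤ 1 - prOne (corrupt f (R ∪ H)) := by linarith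
    positivity
  | succ s ih =>
    obtain ⟨H', hHH', hH', hsat⟩ := exists_saturation f hd R H h1 hH
    set bad : Finset (Fin ℓ) → Prop := fun T =>
      ¬∃ K : Finset (Fin ℓ), (#K : ℝ) ≤ h ∧ CanBias f (T ∪ K) 0.99
    have hmono : prOne (corrupt f (R ∪ H)) ≤ prOne (corrupt f (R ∪ H')) :=
      prOne_corrupt_mono f (union_subset_union_right hHH')
    have hp1 := prOne_le_one (corrupt f (R ∪ H'))
    rcases hsat with hwin | hgain
    · have : {S ∈ powersetCard (s + 1) Rᶜ | bad (R ∪ S)} = (∅ : Finset (Finset (Fin ℓ))) := by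
        refine filter_eq_empty_iff.mpr fun S _ hb => hb ⟨H', ?_, ?_⟩
        · refine hH'.trans (le_trans ?_ hh)
          have : (0 : ℝ) ≤ 2 * 81 ^ d := by positivity
          nlinarith
        · exact hwin.trans (prOne_corrupt_mono f
            (union_subset_union_left subset_union_left))
      rw [this, card_empty, Nat.cast_zero, mul_zero]
      have : 0 ≤ 1 - prOne (corrupt f (R ∪ H)) := by linarith
      positivity
    · set p := prOne (corrupt f (R ∪ H')) with hp
      set m := #Rᶜ with hm
      set c : ℝ := 0.0099 * d with hc
      have hc0 : 0 ≤ c := by positivity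
      set N : ℝ := ((#{S ∈ powersetCard (s + 1) Rᶜ | bad (R ∪ S)} : ℕ) : ℝ) with hN
      have hmℓ : (m : ℝ) ≤ ℓ := by
        exact_mod_cast (card_le_univ Rᶜ).trans_eq (Fintype.card_fin ℓ)
      have hNle : N ≤ m.choose (s + 1) := by
        rw [hN, hm, ← card_powersetCard]
        exact_mod_cast card_filter_le _ _
      have hdc : ∑ i ∈ Rᶜ, (#{S ∈ powersetCard s (insert i R)ᶜ | bad (insert i R ∪ S)} : ℝ)
          = (s + 1) * N := by
        rw [hN]
        exact_mod_cast sum_card_filter_powersetCard_insert bad R s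
      -- Members of R gain nothing, so the whole gain comes from the candidates for addition.
      have hgain' : c ≤ ∑ i ∈ Rᶜ, (prOne (corrupt f (insert i R ∪ H')) - p) := by
        refine hgain.trans_eq (sum_subset (subset_univ _) fun i _ hi => ?_).symm
        rw [insert_eq_self.mpr (by simpa using hi), hp, sub_self]
      have hstep : ∀ i ∈ Rᶜ,
          s * c * (#{S ∈ powersetCard s (insert i R)ᶜ | bad (insert i R ∪ S)} : ℝ)
            ≤ ℓ * (m - 1).choose s * ((1 - p) - (prOne (corrupt f (insert i R ∪ H')) - p)) := by
        intro i hi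
        have hcard : #(insert i R)ᶜ = m - 1 := by
          rw [compl_insert, card_erase_of_mem hi]
        have := ih (insert i R) H' (hH'.trans (by
          gcongr
          exact prOne_corrupt_mono f (union_subset_union_left (subset_insert _ _))))
        rw [hcard] at this
        refine this.trans_eq ?_
        ring
      have hsum := sum_le_sum hstep
      rw [← mul_sum, hdc, ← mul_sum, sum_sub_distrib, sum_const, nsmul_eq_mul] at hsum
      rcases Nat.eq_zero_or_pos m with hm0 | hmpos
      · rw [hm0] at hNle
        have : N = 0 := le_antisymm (by simpa using hNle) (Nat.cast_nonneg _)
        rw [this, mul_zero]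
        have : 0 ≤ 1 - prOne (corrupt f (R ∪ H)) := by linarith
        positivity
      · have hchoose : (m : ℝ) * (m - 1).choose s = (s + 1) * m.choose (s + 1) := by
          have := Nat.add_one_mul_choose_eq (m - 1) s
          rw [Nat.sub_add_cancel hmpos] at this
          rw [mul_comm ((s : ℝ) + 1)]
          exact_mod_cast this
        have hA0 : (0 : ℝ) ≤ (m - 1).choose s := Nat.cast_nonneg _
        have hle : (s + 1) * (s * c * N) ≤ (s + 1) * ((ℓ * (1 - p) - c) * m.choose (s + 1)) := by
          calc (s + 1) * (s * c * N) = s * c * ((s + 1) * N) := by ring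
            _ ≤ ℓ * (m - 1).choose s * (m * (1 - p) - c) :=
              hsum.trans (by gcongr)
            _ ≤ (m - 1).choose s * (m * (ℓ * (1 - p) - c)) := by
              nlinarith [mul_nonneg hA0 (mul_nonneg hc0 (sub_nonneg.mpr hmℓ))]
            _ = _ := by linear_combination (ℓ * (1 - p) - c) * hchoose
        have hle' := le_of_mul_le_mul_left hle (by positivity)
        -- The average gain has saved one c in the bound for s·c·N; adding c·N ≤ c·(m choose s+1)
        -- raises s to s + 1.
        have h3 := mul_le_mul_of_nonneg_left hNle hc0
        have h4 : (ℓ : ℝ) * (1 - p) * m.choose (s + 1)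
            ≤ ℓ * (1 - prOne (corrupt f (R ∪ H))) * m.choose (s + 1) := by
          gcongr
        push_cast
        linarith

/-! ### Choice of the constants and conclusion -/

lemma canBias_univ {ℓ : ℕ} (f : (Fin ℓ → Bool) → Bool) (h1 : 0.01 ≤ prOne f) :
    CanBias f univ 0.99 := by
  obtain ⟨y, hy⟩ : ∃ y, f y = true := by
    by_contra! h
    have : prOne f = 0 := by rw [prOne_eq_sum]; simp [h]
    rw [this] at h1
    norm_num at h1
  have : ∀ x, corrupt f univ x = true := fun x =>
    (corrupt_eq_true_iff f univ x).mpr ⟨y, fun i hi => absurd (mem_univ i) hi, hy⟩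
  rw [CanBias, prOne_eq_sum]
  simp [this]
  norm_num

open Classical in
theorem mainTheorem3 :
    ∃ C : ℝ, 0 < C ∧ ∀ (ℓ : ℕ) (h : ℝ), 1 ≤ h → h ≤ (ℓ : ℝ) ^ (0.99 : ℝ) →
      ∃ r₀ : ℕ, r₀ ≤ ℓ ∧ (r₀ : ℝ) * Real.log h ≤ C * (ℓ : ℝ) ∧
        ∀ r : ℕ, r₀ ≤ r → r ≤ ℓ →
          ∀ f : (Fin ℓ → Bool) → Bool, 0.01 ≤ prOne f →
            0.99 * (#(powersetCard r (univ : Finset (Fin ℓ))) : ℝ) ≤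
              (#{R ∈ powersetCard r (univ : Finset (Fin ℓ)) |
                ∃ H : Finset (Fin ℓ), (#H : ℝ) ≤ h ∧ CanBias f (R ∪ H) 0.99} : ℝ) := by
  refine ⟨300000, by norm_num, fun ℓ h hh1 hhℓ => ?_⟩
  have hlog0 : 0 ≤ Real.log h := Real.log_nonneg hh1
  have hℓ : (1 : ℝ) ≤ ℓ := by
    rcases Nat.eq_zero_or_pos ℓ with h0 | h0
    · rw [h0, Nat.cast_zero, Real.zero_rpow (by norm_num)] at hhℓ
      linarith
    · exact_mod_cast h0
  have hlogℓ : Real.log h ≤ ℓ :=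
    calc Real.log h ≤ h := Real.log_le_self (by linarith)
      _ ≤ (ℓ : ℝ) ^ (0.99 : ℝ) := hhℓ
      _ ≤ (ℓ : ℝ) ^ (1 : ℝ) := Real.rpow_le_rpow_of_exponent_le hℓ (by norm_num)
      _ = ℓ := Real.rpow_one _
  -- The 6 serves 2·81^d ≤ 162^d ≤ e^(6d) ≤ h.
  set d := ⌊Real.log h / 6⌋₊ with hd
  have hd1 : (d : ℝ) ≤ Real.log h / 6 := Nat.floor_le (by positivity)
  have hd2 : Real.log h / 6 < d + 1 := Nat.lt_floor_add_one _
  rcases lt_or_ge d 20000 with hsmall | hlarge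
  -- Here log h < 120000, so r₀ = ℓ is affordable and R consists of all players.
  · refine ⟨ℓ, le_rfl, ?_, fun r hr1 hr2 f hf => ?_⟩
    · have : (d : ℝ) + 1 ≤ 20000 := by exact_mod_cast hsmall
      nlinarith
    · obtain rfl : r = ℓ := le_antisymm hr2 hr1
      rw [filter_true_of_mem]
      · have : (0 : ℝ) ≤ #(powersetCard r (univ : Finset (Fin r))) := Nat.cast_nonneg _
        linarith
      · intro R hR
        have hRu : R = univ := by
          rw [← card_eq_iff_eq_univ, (mem_powersetCard.mp hR).2, Fintype.card_fin]
        refine ⟨∅, by simp; linarith, ?_⟩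
        rw [hRu, union_empty]
        exact canBias_univ f hf
  · have hdpos : 0 < d := by omega
    have hd20 : (20000 : ℝ) ≤ d := by exact_mod_cast hlarge
    have hd0 : (0 : ℝ) < d := by linarith
    have hdh : 2 * 81 ^ d ≤ h := by
      have he : (162 : ℝ) ≤ Real.exp 6 := by
        have h2 : (2.7 : ℝ) ≤ Real.exp 1 := by linarith [Real.exp_one_gt_d9]
        calc (162 : ℝ) ≤ 2.7 ^ 6 := by norm_num
          _ ≤ Real.exp 1 ^ 6 := by gcongr
          _ = Real.exp 6 := by rw [← Real.exp_nat_mul]; norm_num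
      calc (2 * 81 ^ d : ℝ) ≤ 2 ^ d * 81 ^ d := by
            gcongr; exact le_self_pow₀ (by norm_num) hdpos.ne'
        _ = 162 ^ d := by rw [← mul_pow]; norm_num
        _ ≤ Real.exp 6 ^ d := by gcongr
        _ = Real.exp (d * 6) := by rw [← Real.exp_nat_mul]
        _ ≤ Real.exp (Real.log h) := Real.exp_le_exp.mpr (by linarith)
        _ = h := Real.exp_log (by linarith)
    refine ⟨⌈20000 * ℓ / (d : ℝ)⌉₊, ?_, ?_, fun r hr1 hr2 f hf => ?_⟩
    · refine Nat.ceil_le.mpr ?_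
      rw [div_le_iff₀ hd0]
      nlinarith
    · have hc := Nat.ceil_lt_add_one (show 0 ≤ 20000 * ℓ / (d : ℝ) by positivity)
      have h12 : Real.log h ≤ 12 * d := by linarith
      calc (⌈20000 * ℓ / (d : ℝ)⌉₊ : ℝ) * Real.log h
          ≤ (20000 * ℓ / (d : ℝ) + 1) * Real.log h := by gcongr
        _ = 20000 * ℓ / (d : ℝ) * Real.log h + Real.log h := by ring
        _ ≤ 20000 * ℓ / (d : ℝ) * (12 * d) + ℓ := by gcongr
        _ = 240001 * ℓ := by field_simp; ring
        _ ≤ 300000 * ℓ := by linarith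
    · have hr : 20000 * ℓ ≤ r * (d : ℝ) := by
        rw [← div_le_iff₀ hd0]
        exact Nat.ceil_le.mp hr1
      have hp0 : 0 ≤ prOne f := by linarith
      have key := card_bad_extensions_le f hf hdpos hdh r ∅ ∅ (by
        rw [card_empty, Nat.cast_zero, union_empty, corrupt_empty]
        positivity)
      simp only [empty_union, compl_empty, corrupt_empty, card_univ, Fintype.card_fin] at key
      have hsplit := card_filter_add_card_filter_not (s := powersetCard r (univ : Finset (Fin ℓ)))
        (fun R => ∃ H : Finset (Fin ℓ), (#H : ℝ) ≤ h ∧ CanBias f (R ∪ H) 0.99)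
      have hsplit' := congrArg (Nat.cast : ℕ → ℝ) hsplit
      push_cast at hsplit'
      rw [card_powersetCard, card_univ, Fintype.card_fin] at hsplit' ⊢
      set bad : ℝ := (#{S ∈ powersetCard r (univ : Finset (Fin ℓ)) |
        ¬∃ K : Finset (Fin ℓ), (#K : ℝ) ≤ h ∧ CanBias f (S ∪ K) 0.99} : ℝ)
      have hbad0 : 0 ≤ bad := Nat.cast_nonneg _
      have hch0 : (0 : ℝ) ≤ ℓ.choose r := Nat.cast_nonneg _
      -- Here 20000·0.0099 = 198 ≥ 100.
      have hscaled : ℓ * (100 * bad) ≤ ℓ * (ℓ.choose r : ℝ) := by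
        calc ℓ * (100 * bad) ≤ (20000 * ℓ) * (0.0099 * bad) := by
              nlinarith [mul_nonneg (show (0 : ℝ) ≤ ℓ by linarith) hbad0]
          _ ≤ r * (d : ℝ) * (0.0099 * bad) := by gcongr
          _ = r * (0.0099 * d) * bad := by ring
          _ ≤ ℓ * (1 - prOne f) * ℓ.choose r := key
          _ ≤ ℓ * 1 * ℓ.choose r := by gcongr; linarith
          _ = _ := by ring
      have := le_of_mul_le_mul_left hscaled (by linarith)
      linarith
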